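/- Let $G$ be a nontrivial finite abelian group with $n$ elementary divisors, i.e. $G\cong\mathbb{Z}_{p_1^{\alpha_1}}\oplus\cdots\oplus\mathbb{Z}_{p_n^{\alpha_n}}$ with $p_1,\dots,p_n$ (not necessarily distinct) primes and $\alpha_1,\dots,\alpha_n\ge 1$. A base of an action of a group $G$ on a finite set $S$ is a subset $B\subseteq S$ whose pointwise stabilizer in $G$ is trivial; the base size of a faithful action of $G$ on $S$ is the smallest cardinality of a base. Let $\mathcal{B}(G)$ be the set of base sizes of all faithful actions of $G$ on finite sets, and let $\mathcal{D}(G)$ be the set of base sizes of those faithful actions of $G$ on the vertex set $V$ of some finite simple graph $\Gamma$ for which the permutations of $V$ induced by $G$ are exactly the automorphisms of $\Gamma$. Then $$\mathcal{B}(G)=\mathcal{D}(G)=\{1,2,\dots,n\}.$$ -/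

import Mathlib

namespace BaseSizes

/-- A set `B` of points is a base for the action of `G` on `S` if its pointwise stabilizer
in `G` is trivial. -/
def IsBase (G : Type*) {S : Type*} [Group G] [MulAction G S] (B : Set S) : Prop :=
  fixingSubgroup G B = ⊥

/-- The base size of an action: the least cardinality of a finite base. For a faithful action on
a finite set (the only case used below) the whole set is a base, so the minimum is attained. -/
noncomputable def baseSize (G S : Type*) [Group G] [MulAction G S] : ℕ :=
  sInf {k : ℕ | ∃ B : Finset S, IsBase G (B : Set S) ∧ B.card = k}

/-- The action of `G` on `V` is realized as the automorphism group of the simple graph `Γ`: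
the permutations of `V` induced by elements of `G` are exactly the automorphisms of `Γ`. -/
def RealizesAut (G : Type*) {V : Type*} [Group G] [MulAction G V] (Γ : SimpleGraph V) : Prop :=
  Set.range (fun g : G => MulAction.toPerm g) =
    Set.range (fun φ : Γ ≃g Γ => (φ.toEquiv : Equiv.Perm V))

/-- The base size set `𝓑(G)`: all base sizes of faithful actions of `G` on finite sets.
Every finite set has a copy in `Type`, so letting `S` range over `Type` loses nothing. -/
def baseSizeSet (G : Type*) [Group G] : Set ℕ :=
  {b | ∃ (S : Type) (_ : Finite S) (_ : MulAction G S), FaithfulSMul G S ∧ baseSize G S = b}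

/-- The determining set `𝓓(G)`: all base sizes of those faithful actions of `G` on finite sets
that are realized as the automorphism group of a finite graph. -/
def determiningSet (G : Type*) [Group G] : Set ℕ :=
  {b | ∃ (V : Type) (_ : Finite V) (_ : MulAction G V), FaithfulSMul G V ∧
    (∃ Γ : SimpleGraph V, RealizesAut G Γ) ∧ baseSize G V = b}

/-- `d 0, …, d (n - 1)` is the list of elementary divisors of the abelian group `G`: each entry is
a prime power `p ^ α` with `α ≥ 1`, and `G` is isomorphic to the direct sum of the cyclic groups
`ℤ / d i`. -/
def HasElementaryDivisors (G : Type*) [CommGroup G] {n : ℕ} (d : Fin n → ℕ) : Prop :=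
  (∀ i, IsPrimePow (d i)) ∧ Nonempty (Additive G ≃+ ((i : Fin n) → ZMod (d i)))

end BaseSizes

/-! Upper bound: let `K` be the socle of `G`, cut out of each cyclic factor by the prime of that
factor. Its order has at most `n` prime factors. Fixing a point moved by the surviving part of `K`
shrinks that part to a proper subgroup, so at most `n` points make it trivial. Their stabilizer then
meets `K` trivially, hence contains no element of prime order and is trivial.

Lower bound: for `1 ≤ k ≤ n`, group the cyclic factors into `k` nontrivial blocks `H j`. Let `G` act
on a disjoint union of coloured Cayley-type graphs, one per block, whose colour-preserving
automorphisms are exactly the blockwise left translations. A base must meet every block, and one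
point per block suffices. Rigid tag vertices then encode the colours in a simple graph. -/

namespace BaseSizes

open Finset

/-! ### Upper bound: stabilizer chains in the socle. -/

section UpperBound

variable {G : Type*} [Group G] [Finite G] {S : Type*} [MulAction G S]

/-- A subgroup `K` acting faithfully is cut down to the trivial group by fixing at most as many
points as `Nat.card K` has prime factors. -/
theorem exists_finset_inf_fixingSubgroup_eq_bot [FaithfulSMul G S] (K : Subgroup G) :
    ∃ B : Finset S, B.card ≤ ArithmeticFunction.cardFactors (Nat.card K) ∧
      K ⊓ fixingSubgroup G (B : Set S) = ⊥ := by
  classical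
  induction hm : Nat.card K using Nat.strong_induction_on generalizing K with
  | _ m ih =>
  subst hm
  rcases eq_or_ne K ⊥ with rfl | hK
  · exact ⟨∅, by simp, by simp⟩
  obtain ⟨g, hgK, hg⟩ := K.bot_or_exists_ne_one.resolve_left hK
  obtain ⟨s, hs⟩ : ∃ s : S, g • s ≠ s := by
    by_contra! h
    exact hg (FaithfulSMul.eq_of_smul_eq_smul (α := S) fun a => by rw [h a, one_smul])
  have hle : K ⊓ MulAction.stabilizer G s ≤ K := inf_le_left
  have hdvd := Subgroup.card_dvd_of_le hle
  have hne : Nat.card (K ⊓ MulAction.stabilizer G s : Subgroup G) ≠ Nat.card K := by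
    intro h
    have := Subgroup.eq_of_le_of_card_ge hle h.ge
    rw [← this] at hgK
    exact hs hgK.2
  have hlt := lt_of_le_of_ne (Nat.le_of_dvd Nat.card_pos hdvd) hne
  obtain ⟨B, hB, hfix⟩ := ih _ hlt _ rfl
  refine ⟨insert s B, ?_, ?_⟩
  -- A proper divisor of `Nat.card K` has strictly fewer prime factors, which pays for the point
  -- `s`.
  · have h : ArithmeticFunction.cardFactors
        (Nat.card (K ⊓ MulAction.stabilizer G s : Subgroup G)) <
        ArithmeticFunction.cardFactors (Nat.card K) := by
      obtain ⟨t, ht⟩ := hdvd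
      have hpos : Nat.card K ≠ 0 := Nat.card_pos.ne'
      have ht0 : t ≠ 0 := by rintro rfl; exact hpos (by simpa using ht)
      have ht1 : t ≠ 1 := by rintro rfl; exact hne (by simpa using ht.symm)
      rw [ht, ArithmeticFunction.cardFactors_mul Nat.card_pos.ne' ht0]
      have : ArithmeticFunction.cardFactors t ≠ 0 := by
        rw [Ne, ArithmeticFunction.cardFactors_eq_zero_iff_eq_zero_or_one]
        tauto
      omega
    have := Finset.card_insert_le s B
    omega
  · rw [eq_bot_iff, ← hfix]
    intro x hx
    obtain ⟨hxK, hx⟩ := Subgroup.mem_inf.1 hx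
    rw [mem_fixingSubgroup_iff] at hx
    refine Subgroup.mem_inf.2 ⟨Subgroup.mem_inf.2 ⟨hxK, hx s (by simp)⟩, ?_⟩
    rw [mem_fixingSubgroup_iff]
    exact fun y hy => hx y (by simp only [coe_insert]; exact Or.inr hy)

theorem exists_mem_orderOf_prime {L : Subgroup G} (hL : L ≠ ⊥) :
    ∃ g ∈ L, (orderOf g).Prime := by
  obtain ⟨p, hp, hdvd⟩ := Nat.exists_prime_and_dvd
    (fun h => hL (Subgroup.card_eq_one.1 h) : Nat.card L ≠ 1)
  have := Fact.mk hp
  obtain ⟨g, hg⟩ := exists_prime_orderOf_dvd_card' p hdvd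
  exact ⟨g, g.2, by rw [Subgroup.orderOf_coe, hg]; exact hp⟩

end UpperBound

/-- The kernel is cyclic, so its order equals its exponent, which divides `p`. -/
theorem cardFactors_card_ker_nsmul_le_one {p m : ℕ} (hp : p.Prime) [NeZero m] :
    ArithmeticFunction.cardFactors
      (Nat.card (nsmulAddMonoidHom p : ZMod m →+ ZMod m).ker) ≤ 1 := by
  have h : Nat.card (nsmulAddMonoidHom p : ZMod m →+ ZMod m).ker ∣ p := by
    rw [← IsAddCyclic.exponent_eq_card]
    refine AddMonoid.exponent_dvd_of_forall_nsmul_eq_zero fun a => Subtype.ext ?_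
    exact a.2
  rcases (Nat.dvd_prime hp).1 h with h | h <;> rw [h]
  · simp
  · simp [ArithmeticFunction.cardFactors_apply_prime hp]

theorem exists_subgroup_cardFactors_le {G : Type*} [CommGroup G] [Finite G] {n : ℕ}
    {d : Fin n → ℕ} (hd : HasElementaryDivisors G d) :
    ∃ K : Subgroup G, ArithmeticFunction.cardFactors (Nat.card K) ≤ n ∧
      ∀ L : Subgroup G, K ⊓ L = ⊥ → L = ⊥ := by
  obtain ⟨hpow, ⟨e⟩⟩ := hd
  choose p a hp ha hpa using fun i => (isPrimePow_nat_iff _).1 (hpow i)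
  have : ∀ i, NeZero (d i) := fun i => ⟨(hpow i).ne_zero⟩
  let N : ∀ i, AddSubgroup (ZMod (d i)) := fun i => (nsmulAddMonoidHom (p i)).ker
  let K : Subgroup G := AddSubgroup.toSubgroup'
    ((AddSubgroup.pi Set.univ N).comap e.toAddMonoidHom)
  have hmem : ∀ g : G, g ∈ K ↔ ∀ i, p i • e (Additive.ofMul g) i = 0 := by
    intro g
    change e (Additive.ofMul g) ∈ AddSubgroup.pi Set.univ N ↔ _
    simp [AddSubgroup.mem_pi, N, AddMonoidHom.mem_ker]
  refine ⟨K, ?_, ?_⟩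
  · let φ : K → ∀ i, N i := fun g i =>
      ⟨e (Additive.ofMul g.1) i, (AddMonoidHom.mem_ker).2 ((hmem g).1 g.2 i)⟩
    have hφ : Function.Bijective φ := by
      constructor
      · intro g h hgh
        apply Subtype.ext
        apply Additive.ofMul.injective
        apply e.injective
        funext i
        exact congrArg Subtype.val (congrFun hgh i)
      · intro f
        refine ⟨⟨(e.symm fun i => (f i).1).toMul, ?_⟩, ?_⟩
        · rw [hmem]
          intro i
          rw [ofMul_toMul, e.apply_symm_apply]
          exact (AddMonoidHom.mem_ker).1 (f i).2
        · funext i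
          apply Subtype.ext
          simp [φ]
    rw [Nat.card_congr (Equiv.ofBijective φ hφ), Nat.card_pi]
    have key : ∀ s : Finset (Fin n), ArithmeticFunction.cardFactors (∏ i ∈ s, Nat.card (N i)) ≤
        s.card := by
      intro s
      induction s using Finset.induction_on with
      | empty => simp
      | insert i s hi ih =>
        rw [Finset.prod_insert hi, Finset.card_insert_of_notMem hi,
          ArithmeticFunction.cardFactors_mul Nat.card_pos.ne'
            (Finset.prod_ne_zero_iff.2 fun _ _ => Nat.card_pos.ne')]
        have := cardFactors_card_ker_nsmul_le_one (m := d i) (hp i)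
        change ArithmeticFunction.cardFactors (Nat.card (N i)) ≤ 1 at this
        omega
    simpa using key Finset.univ
  · intro L hL
    by_contra hne
    obtain ⟨g, hgL, hg⟩ := exists_mem_orderOf_prime hne
    have hgK : g ∈ K := by
      rw [hmem]
      intro i
      have h1 : orderOf g • e (Additive.ofMul g) i = 0 := by
        rw [← Pi.smul_apply, ← map_nsmul, ← ofMul_pow, pow_orderOf_eq_one]
        simp
      have h2 : d i • e (Additive.ofMul g) i = 0 := by simp
      by_cases h0 : e (Additive.ofMul g) i = 0
      · simp [h0]
      -- A nonzero coordinate has the same prime order as `g`; this prime divides `p i ^ a i`, so it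
      -- is `p i`.
      · have h3 := (Nat.dvd_prime hg).1 (addOrderOf_dvd_of_nsmul_eq_zero h1)
        have h4 : addOrderOf (e (Additive.ofMul g) i) ≠ 1 := by simpa using h0
        have h5 := h3.resolve_left h4
        have h6 := addOrderOf_dvd_of_nsmul_eq_zero h2
        rw [h5, ← hpa i] at h6
        rw [← (Nat.prime_dvd_prime_iff_eq hg (hp i)).1 (hg.dvd_of_dvd_pow h6), h1]
    have : g ∈ K ⊓ L := ⟨hgK, hgL⟩
    rw [hL, Subgroup.mem_bot] at this
    rw [this, orderOf_one] at hg
    exact Nat.not_prime_one hg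

theorem baseSizeSet_subset_Icc {G : Type*} [CommGroup G] [Finite G] [Nontrivial G] {n : ℕ}
    {d : Fin n → ℕ} (hd : HasElementaryDivisors G d) : baseSizeSet G ⊆ Set.Icc 1 n := by
  rintro b ⟨S, _, _, _, rfl⟩
  obtain ⟨K, hK, hKL⟩ := exists_subgroup_cardFactors_le hd
  obtain ⟨B, hB, hfix⟩ := exists_finset_inf_fixingSubgroup_eq_bot (S := S) K
  have hBmem : B.card ∈ {k : ℕ | ∃ B : Finset S, IsBase G (B : Set S) ∧ B.card = k} :=
    ⟨B, hKL _ hfix, rfl⟩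
  refine ⟨?_, (Nat.sInf_le hBmem).trans (hB.trans hK)⟩
  -- The infimum is attained, so it is not the default value `0` of `sInf ∅`; an empty base would
  -- make `G` trivial.
  obtain ⟨C, hC, hcard⟩ := Nat.sInf_mem ⟨_, hBmem⟩
  rw [baseSize, ← hcard, Nat.one_le_iff_ne_zero, Finset.card_ne_zero, nonempty_iff_ne_empty]
  rintro rfl
  simp [IsBase] at hC

/-- The graph `Γ` extended by the complement of a path on `Fin M`, a vertex `x` of `Γ` being joined
to the initial segment of `Fin M` that ends at the colour of `x`. -/
def tagGraph {X : Type*} (Γ : SimpleGraph X) (c : X → ℕ) (M : ℕ) : SimpleGraph (X ⊕ Fin M) where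
  Adj
    | .inl x, .inl y => Γ.Adj x y
    | .inl x, .inr i => (i : ℕ) ≤ c x
    | .inr i, .inl x => (i : ℕ) ≤ c x
    | .inr i, .inr j => (i : ℕ) + 1 < j ∨ (j : ℕ) + 1 < i
  symm := ⟨by rintro (x | i) (y | j) h <;> first | exact h.symm | exact h⟩
  loopless := ⟨by
    rintro (x | i) h
    · exact Γ.loopless.irrefl x h
    · rcases h with h | h <;> omega⟩

/-! ### Encoding vertex colours by rigid tags. -/

section TagGraph

variable {X : Type*} {Γ : SimpleGraph X} {c : X → ℕ} {M : ℕ}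

@[simp] theorem tagGraph_adj_inr_inl {x : X} {i : Fin M} :
    (tagGraph Γ c M).Adj (.inr i) (.inl x) ↔ (i : ℕ) ≤ c x := Iff.rfl

@[simp] theorem tagGraph_adj_inr_inr {i j : Fin M} :
    (tagGraph Γ c M).Adj (.inr i) (.inr j) ↔ (i : ℕ) + 1 < j ∨ (j : ℕ) + 1 < i := Iff.rfl

theorem ncard_neighborSet_inl_le [Finite X] (x : X) :
    ((tagGraph Γ c M).neighborSet (.inl x)).ncard ≤ Nat.card X + (c x + 1) := by
  have hsub : (tagGraph Γ c M).neighborSet (.inl x) ⊆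
      Set.range Sum.inl ∪ Sum.inr '' {i : Fin M | (i : ℕ) ≤ c x} := by
    rintro (y | i) h
    · exact Or.inl ⟨y, rfl⟩
    · exact Or.inr ⟨i, h, rfl⟩
  refine (Set.ncard_le_ncard hsub (Set.toFinite _)).trans ((Set.ncard_union_le _ _).trans ?_)
  refine add_le_add ?_ ?_
  · rw [← Set.image_univ, ← Set.ncard_univ]
    exact Set.ncard_image_le (Set.toFinite _)
  · refine (Set.ncard_image_le (Set.toFinite _)).trans ?_
    rw [← Set.ncard_image_of_injective _ Fin.val_injective]
    refine (Set.ncard_le_ncard (t := (Finset.range (c x + 1) : Set ℕ)) ?_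
      (Set.toFinite _)).trans ?_
    · rintro _ ⟨i, hi, rfl⟩
      simpa [Nat.lt_succ_iff] using hi
    · rw [Set.ncard_coe_finset, Finset.card_range]

theorem le_ncard_neighborSet_inr [Finite X] (i : Fin M) :
    M ≤ ((tagGraph Γ c M).neighborSet (.inr i)).ncard + 3 := by
  have hsub : (Set.univ : Set (Fin M)) ⊆
      (Sum.inr ⁻¹' (tagGraph Γ c M).neighborSet (.inr i)) ∪
        Fin.val ⁻¹' ({(i : ℕ) - 1, (i : ℕ), (i : ℕ) + 1} : Finset ℕ) := by
    intro j _
    simp only [Set.mem_union, Set.mem_preimage, SimpleGraph.mem_neighborSet,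
      tagGraph_adj_inr_inr, Finset.mem_coe, Finset.mem_insert, Finset.mem_singleton]
    omega
  have h := (Set.ncard_le_ncard hsub (Set.toFinite _)).trans (Set.ncard_union_le _ _)
  rw [Set.ncard_univ, Nat.card_fin] at h
  refine h.trans (add_le_add ?_ ?_)
  · rw [← Set.ncard_image_of_injective _ (Sum.inr_injective (α := X))]
    exact Set.ncard_le_ncard (Set.image_preimage_subset _ _) (Set.toFinite _)
  · rw [← Set.ncard_image_of_injective _ Fin.val_injective]
    refine (Set.ncard_le_ncard (Set.image_preimage_subset _ _) (Set.toFinite _)).trans ?_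
    rw [Set.ncard_coe_finset]
    exact Finset.card_le_three

theorem ncard_neighborSet_iso {V : Type*} {Δ : SimpleGraph V} (φ : Δ ≃g Δ) (v : V) :
    (Δ.neighborSet (φ v)).ncard = (Δ.neighborSet v).ncard :=
  (Nat.card_congr (φ.mapNeighborSet v)).symm

/-- Automorphisms of a tagged graph fix the tags when there are enough of them. -/
theorem tagGraph_iso_inr [Finite X] (hM : ∀ x, Nat.card X + c x + 4 < M) (x₀ : X) (hx₀ : c x₀ = 0)
    (φ : tagGraph Γ c M ≃g tagGraph Γ c M) (i : Fin M) : φ (.inr i) = .inr i := by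
  have hinr : ∀ ψ : tagGraph Γ c M ≃g tagGraph Γ c M, ∀ i, ∃ j, ψ (.inr i) = .inr j := by
    intro ψ i
    rcases h : ψ (.inr i) with x | j
    -- By `hM`, tags have larger degree than all original vertices.
    · have h1 := ncard_neighborSet_iso ψ (.inr i)
      have h2 := le_ncard_neighborSet_inr (Γ := Γ) (c := c) i
      have h3 := ncard_neighborSet_inl_le (Γ := Γ) (c := c) (M := M) x
      have h4 := hM x
      rw [h] at h1
      omega
    · exact ⟨j, rfl⟩
  have hinl : ∀ x, ∃ y, φ.symm (.inl x) = .inl y := by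
    intro x
    rcases h : φ.symm (.inl x) with y | j
    · exact ⟨y, rfl⟩
    · obtain ⟨k, hk⟩ := hinr φ j
      rw [← h, φ.apply_symm_apply] at hk
      simp at hk
  have key : ∀ m, ∀ hm : m < M, φ (.inr ⟨m, hm⟩) = .inr ⟨m, hm⟩ := by
    intro m
    induction m using Nat.strong_induction_on with
    | _ m ih =>
    intro hm
    obtain ⟨j, hj⟩ := hinr φ ⟨m, hm⟩
    rw [hj]
    congr 1
    apply Fin.ext
    change (j : ℕ) = m
    rcases m with _ | m
    -- Tag `0` sees every original vertex, and is the only tag that sees `x₀`.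
    · obtain ⟨y, hy⟩ := hinl x₀
      have h : (tagGraph Γ c M).Adj (.inr ⟨0, hm⟩) (.inl y) := Nat.zero_le _
      rw [← φ.map_adj_iff, hj, ← hy, φ.apply_symm_apply, tagGraph_adj_inr_inl] at h
      omega
    -- The image of tag `m + 1` is not adjacent to the fixed tag `m`, so its index is at most `m +
    -- 1`; injectivity excludes the smaller indices.
    · have hprev := ih m (Nat.lt_succ_self m) (by omega)
      have hnot : ¬ (tagGraph Γ c M).Adj (.inr ⟨m, by omega⟩) (.inr ⟨m + 1, hm⟩) := by
        rw [tagGraph_adj_inr_inr]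
        simp only
        omega
      rw [← φ.map_adj_iff, hj, hprev, tagGraph_adj_inr_inr] at hnot
      have hge : m < (j : ℕ) := by
        by_contra hle
        have h1 := ih j (by omega) j.2
        have h2 : (⟨m + 1, hm⟩ : Fin M) = j := Sum.inr_injective (φ.injective (hj.trans h1.symm))
        have h3 := congrArg Fin.val h2
        simp only at h3
        omega
      simp only at hnot
      omega
  exact key i i.2

/-- Automorphisms of a tagged graph are the colour preserving automorphisms of the original one. -/
theorem tagGraph_iso_inl [Finite X] (hM : ∀ x, Nat.card X + c x + 4 < M) (x₀ : X) (hx₀ : c x₀ = 0)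
    (φ : tagGraph Γ c M ≃g tagGraph Γ c M) :
    ∃ f : X → X, (∀ x, φ (.inl x) = .inl (f x)) ∧ (∀ x, c (f x) = c x) ∧
      ∀ x y, Γ.Adj x y → Γ.Adj (f x) (f y) := by
  have hfix := tagGraph_iso_inr hM x₀ hx₀ φ
  have h : ∀ x, ∃ y, φ (.inl x) = .inl y := by
    intro x
    rcases h : φ (.inl x) with y | j
    · exact ⟨y, rfl⟩
    · rw [← hfix j] at h
      exact absurd (φ.injective h) (by simp)
  choose f hf using h
  refine ⟨f, hf, fun x => ?_, fun x y hxy => ?_⟩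
  · have key : ∀ m < M, m ≤ c x ↔ m ≤ c (f x) := by
      intro m hm
      have := φ.map_adj_iff (v := .inl x) (w := .inr ⟨m, hm⟩)
      rw [hfix, hf] at this
      exact this.symm
    have h1 := hM x
    have h2 := hM (f x)
    have h3 := (key (c x) (by omega)).1 le_rfl
    have h4 := (key (c (f x)) (by omega)).2 le_rfl
    omega
  · have := (φ.map_adj_iff (v := .inl x) (w := .inl y)).2 hxy
    rwa [hf, hf] at this

end TagGraph

/-! ### Realizing a product of `k` nontrivial groups with base size `k`. -/

section Product

variable {ι : Type} {H : ι → Type} [∀ j, Group (H j)]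

/-- The vertex `⟨j, g, some s⟩` stands for the arc of the complete digraph on `H j` from `g` to
`g * s`, and `⟨j, h, none⟩` for the point `h`. -/
abbrev ArcVertex (H : ι → Type) : Type := Σ j, H j × Option (H j)

/-- Arcs with the same source are adjacent, and an arc is adjacent to its target. -/
inductive ArcAdj : ArcVertex H → ArcVertex H → Prop
  | source (j : ι) (g s t : H j) (h : s ≠ t) : ArcAdj ⟨j, g, some s⟩ ⟨j, g, some t⟩
  | target (j : ι) (g s : H j) : ArcAdj ⟨j, g, some s⟩ ⟨j, g * s, none⟩
  | target_symm (j : ι) (g s : H j) : ArcAdj ⟨j, g * s, none⟩ ⟨j, g, some s⟩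

/-- The disjoint union over `j` of the graphs of arcs and points of `H j`. -/
def arcGraph (H : ι → Type) [∀ j, Group (H j)] : SimpleGraph (ArcVertex H) where
  Adj := ArcAdj
  symm := ⟨by
    rintro _ _ (⟨j, g, s, t, h⟩ | ⟨j, g, s⟩ | ⟨j, g, s⟩)
    · exact .source j g t s h.symm
    · exact .target_symm j g s
    · exact .target j g s⟩
  loopless := ⟨by
    have hne : ∀ x y : ArcVertex H, ArcAdj x y → x ≠ y := by
      rintro _ _ (⟨j, g, s, t, h⟩ | ⟨j, g, s⟩ | ⟨j, g, s⟩) <;> simp [*]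
    exact fun x h => hne x x h rfl⟩

/-- Left translation by `u j` on the part of index `j`. -/
def arcTranslate (u : ∀ j, H j) (x : ArcVertex H) : ArcVertex H := ⟨x.1, u x.1 * x.2.1, x.2.2⟩

theorem arcGraph_adj_arcTranslate (u : ∀ j, H j) {x y : ArcVertex H}
    (h : (arcGraph H).Adj x y) : (arcGraph H).Adj (arcTranslate u x) (arcTranslate u y) := by
  rcases h with ⟨j, g, s, t, h⟩ | ⟨j, g, s⟩ | ⟨j, g, s⟩
  · exact ArcAdj.source j (u j * g) s t h
  · have := ArcAdj.target j (u j * g) s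
    rwa [mul_assoc] at this
  · have := ArcAdj.target_symm j (u j * g) s
    rwa [mul_assoc] at this

/-- The colour of an arc or point: its index together with its label. -/
def arcColour (x : ArcVertex H) : Σ j, Option (H j) := ⟨x.1, x.2.2⟩

/-- Colours fix the part and the label. Edges between arcs of common source force one source map for
all labels, and target edges make it commute with right multiplication, so it is a left translation.
-/
theorem eq_arcTranslate {f : ArcVertex H → ArcVertex H}
    (hc : ∀ x, arcColour (f x) = arcColour x)
    (hf : ∀ x y, (arcGraph H).Adj x y → (arcGraph H).Adj (f x) (f y)) :
    ∃ u : ∀ j, H j, f = arcTranslate u := by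
  have h : ∀ j t g, ∃ g', f ⟨j, g, t⟩ = ⟨j, g', t⟩ := by
    intro j t g
    have h := hc ⟨j, g, t⟩
    rcases hx : f ⟨j, g, t⟩ with ⟨j', g', t'⟩
    rw [hx] at h
    simp only [arcColour] at h
    cases h
    exact ⟨g', rfl⟩
  choose σ hσ using h
  have hsource : ∀ j g s, σ j (some s) g = σ j (some 1) g := by
    intro j g s
    rcases eq_or_ne s 1 with rfl | hs
    · rfl
    have h := hf _ _ (ArcAdj.source j g s 1 hs)
    rw [hσ, hσ] at h
    generalize σ j (some s) g = a, σ j (some 1) g = b at h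
    cases h
    rfl
  have htarget : ∀ j g s, σ j none (g * s) = σ j (some s) g * s := by
    intro j g s
    have h := hf _ _ (ArcAdj.target j g s)
    rw [hσ, hσ] at h
    generalize σ j (some s) g = a, σ j none (g * s) = b at h
    cases h
    rfl
  have hnone : ∀ j g, σ j none g = σ j (some 1) 1 * g := by
    intro j g
    rw [← hsource j 1 g, ← htarget, one_mul]
  refine ⟨fun j => σ j (some 1) 1, funext ?_⟩
  rintro ⟨j, g, _ | s⟩
  · rw [hσ, hnone]
    rfl
  -- The arc labelled `1` is a loop at `g`, so sources move as points do.
  · have := htarget j g 1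
    rw [mul_one, mul_one, hnone] at this
    rw [hσ, hsource, ← this]
    rfl

/-- Translation of the arc graph and trivial action on the tags. -/
abbrev taggedAction {G : Type*} [Group G] (e : G →* ∀ j, H j) (M : ℕ) :
    MulAction G (ArcVertex H ⊕ Fin M) where
  smul g := Sum.map (arcTranslate (e g)) id
  one_smul := by
    rintro (⟨j, g, t⟩ | i)
    · change Sum.inl (⟨j, e 1 j * g, t⟩ : ArcVertex H) = _
      simp
    · rfl
  mul_smul a b := by
    rintro (⟨j, g, t⟩ | i)
    · change Sum.inl (⟨j, e (a * b) j * g, t⟩ : ArcVertex H) =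
        Sum.inl (⟨j, e a j * (e b j * g), t⟩ : ArcVertex H)
      simp [mul_assoc]
    · rfl

theorem card_mem_determiningSet {G : Type*} [Group G] [Finite ι] [Nonempty ι]
    [∀ j, Finite (H j)] [∀ j, Nontrivial (H j)] (e : G ≃* ∀ j, H j) :
    Nat.card ι ∈ determiningSet G := by
  classical
  have := Fintype.ofFinite ι
  obtain ⟨m, ⟨k⟩⟩ := Finite.exists_equiv_fin (Σ j, Option (H j))
  let c : ArcVertex H → ℕ := fun x => k (arcColour x)
  let M := Nat.card (ArcVertex H) + m + 5
  have hM : ∀ x, Nat.card (ArcVertex H) + c x + 4 < M := by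
    intro x
    have := (k (arcColour x)).2
    simp only [c, M]
    omega
  obtain ⟨x₀, hx₀⟩ : ∃ x₀, c x₀ = 0 := by
    have hm : 0 < m := (k ⟨Classical.arbitrary ι, none⟩).pos
    refine ⟨⟨(k.symm ⟨0, hm⟩).1, 1, (k.symm ⟨0, hm⟩).2⟩, ?_⟩
    change ((k (k.symm ⟨0, hm⟩) : Fin m) : ℕ) = 0
    simp
  let act : MulAction G (ArcVertex H ⊕ Fin M) := taggedAction e.toMonoidHom M
  have smul_inl : ∀ (g : G) (j : ι) (h : H j) (t : Option (H j)),
      g • (Sum.inl ⟨j, h, t⟩ : ArcVertex H ⊕ Fin M) = Sum.inl ⟨j, e g j * h, t⟩ :=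
    fun _ _ _ _ => rfl
  have smul_inr : ∀ (g : G) (i : Fin M),
      g • (Sum.inr i : ArcVertex H ⊕ Fin M) = Sum.inr i := fun _ _ => rfl
  have fix : ∀ (g : G) (j : ι) (h : H j) (t : Option (H j)),
      g • (Sum.inl ⟨j, h, t⟩ : ArcVertex H ⊕ Fin M) = Sum.inl ⟨j, h, t⟩ ↔ e g j = 1 := by
    intro g j h t
    rw [smul_inl]
    constructor
    · intro hh
      have hh := Sum.inl_injective hh
      simpa using hh
    · intro hh
      rw [hh, one_mul]
  have eq_one : ∀ g : G, (∀ j, e g j = 1) → g = 1 := by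
    intro g hg
    exact e.injective ((funext hg).trans (map_one e).symm)
  let B : Finset (ArcVertex H ⊕ Fin M) := Finset.univ.image fun j => Sum.inl (⟨j, 1, none⟩ : ArcVertex H)
  have hB : IsBase G (B : Set (ArcVertex H ⊕ Fin M)) := by
    rw [IsBase, eq_bot_iff]
    intro g hg
    rw [mem_fixingSubgroup_iff] at hg
    exact eq_one g fun j => (fix g j 1 none).1 (hg _ (by simp [B]))
  refine ⟨ArcVertex H ⊕ Fin M, inferInstance, act, ⟨?_⟩, ⟨tagGraph (arcGraph H) c M, ?_⟩, ?_⟩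
  · intro a b hab
    have h := fun j => hab (Sum.inl ⟨j, 1, none⟩)
    simp only [smul_inl] at h
    refine e.injective (funext fun j => ?_)
    simpa using Sum.inl_injective (h j)
  · apply Set.Subset.antisymm
    · rintro _ ⟨g, rfl⟩
      have hadj : ∀ (g : G) (v w : ArcVertex H ⊕ Fin M),
          (tagGraph (arcGraph H) c M).Adj v w →
            (tagGraph (arcGraph H) c M).Adj (g • v) (g • w) := by
        rintro g (x | i) (y | j) h
        · exact arcGraph_adj_arcTranslate (e g) h
        · exact h
        · exact h
        · exact h
      refine ⟨⟨MulAction.toPerm g, fun {v w} => ⟨fun h => ?_, hadj g v w⟩⟩, rfl⟩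
      simpa using hadj g⁻¹ _ _ h
    · rintro _ ⟨φ, rfl⟩
      obtain ⟨f, hφ, hfc, hadj⟩ := tagGraph_iso_inl hM x₀ hx₀ φ
      obtain ⟨u, rfl⟩ := eq_arcTranslate
        (fun x => k.injective (Fin.ext (hfc x))) hadj
      refine ⟨e.symm u, Equiv.ext ?_⟩
      rintro (⟨j, h, t⟩ | i)
      · refine Eq.trans ?_ (hφ _).symm
        change Sum.inl (⟨j, e (e.symm u) j * h, t⟩ : ArcVertex H) = _
        rw [e.apply_symm_apply]
        rfl
      · exact (tagGraph_iso_inr hM x₀ hx₀ φ i).symm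
  · have hmem : B.card ∈ {b : ℕ | ∃ C : Finset (ArcVertex H ⊕ Fin M),
        IsBase G (C : Set (ArcVertex H ⊕ Fin M)) ∧ C.card = b} := ⟨B, hB, rfl⟩
    apply le_antisymm
    · refine (Nat.sInf_le hmem).trans (Finset.card_image_le.trans ?_)
      simp [Nat.card_eq_fintype_card]
    · refine le_csInf ⟨_, hmem⟩ ?_
      rintro _ ⟨C, hC, rfl⟩
      have hmeet : ∀ j : ι, ∃ x ∈ C, ∃ y : H j × Option (H j), x = Sum.inl ⟨j, y⟩ := by
        intro j
        by_contra! hno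
        -- An element supported on the factor `H j` fixes everything outside part `j`.
        obtain ⟨h, hh⟩ := exists_ne (1 : H j)
        have hmem : e.symm (Pi.mulSingle j h) ∈
            fixingSubgroup G (C : Set (ArcVertex H ⊕ Fin M)) := by
          rw [mem_fixingSubgroup_iff]
          rintro (⟨j', g, t⟩ | i) hx
          · rw [fix, e.apply_symm_apply]
            refine Pi.mulSingle_eq_of_ne ?_ h
            rintro rfl
            exact hno _ hx (g, t) rfl
          · rfl
        rw [IsBase] at hC
        rw [hC, Subgroup.mem_bot, map_eq_one_iff e.symm e.symm.injective,
          Pi.mulSingle_eq_one_iff] at hmem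
        exact hh hmem
      choose x hxC y hxy using hmeet
      have hinj : Function.Injective fun j => (⟨x j, hxC j⟩ : C) := by
        intro i j hij
        have h : x i = x j := congrArg Subtype.val hij
        rw [hxy, hxy] at h
        exact congrArg Sigma.fst (Sum.inl_injective h)
      have := Nat.card_le_card_of_injective _ hinj
      simpa using this

end Product

theorem Icc_subset_determiningSet {G : Type*} [CommGroup G] {n : ℕ}
    {d : Fin n → ℕ} (hd : HasElementaryDivisors G d) : Set.Icc 1 n ⊆ determiningSet G := by
  rintro k ⟨hk1, hkn⟩
  obtain ⟨hpow, ⟨e⟩⟩ := hd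
  have : ∀ i, NeZero (d i) := fun i => ⟨(hpow i).ne_zero⟩
  have : ∀ i, Fact (1 < d i) := fun i => ⟨(hpow i).one_lt⟩
  have : Nonempty (Fin k) := ⟨⟨0, hk1⟩⟩
  -- The first `k - 1` divisors get a block each and the rest share the last one; `k ≤ n` leaves no
  -- block empty.
  let q : Fin n → Fin k := fun i => ⟨min i (k - 1), by omega⟩
  let H : Fin k → Type := fun j => Multiplicative (∀ i : {i // q i = j}, ZMod (d i))
  let _ : ∀ j, Group (H j) := fun j => inferInstanceAs (Group (Multiplicative _))
  have : ∀ j, Finite (H j) := fun j => inferInstanceAs (Finite (Multiplicative _))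
  have : ∀ j, Nontrivial (H j) := by
    intro j
    let i : {i // q i = j} := ⟨⟨j, by omega⟩, Fin.ext (by simp only [q]; omega)⟩
    have : Nontrivial (∀ i : {i // q i = j}, ZMod (d i)) := Pi.nontrivial_at i
    exact Function.Injective.nontrivial (f := fun f : ∀ i : {i // q i = j}, ZMod (d i) =>
      (Multiplicative.ofAdd f : H j)) Multiplicative.ofAdd.injective
  let φ : G →* ∀ j, H j :=
    { toFun := fun g j => Multiplicative.ofAdd fun i => e (Additive.ofMul g) i
      map_one' := by
        funext j
        apply Multiplicative.toAdd.injective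
        funext i
        simp
      map_mul' := by
        intro a b
        funext j
        apply Multiplicative.toAdd.injective
        funext i
        simp }
  have hφ : Function.Bijective φ := by
    constructor
    · intro a b hab
      apply Additive.ofMul.injective
      apply e.injective
      funext i
      exact congrFun (congrArg Multiplicative.toAdd (congrFun hab (q i))) ⟨i, rfl⟩
    · intro f
      refine ⟨(e.symm fun i => (f (q i)).toAdd ⟨i, rfl⟩).toMul, ?_⟩
      funext j
      apply Multiplicative.toAdd.injective
      funext ⟨i, hi⟩
      subst hi
      simp [φ]
  simpa using card_mem_determiningSet (MulEquiv.ofBijective φ hφ)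

theorem determiningSet_subset_baseSizeSet (G : Type*) [Group G] :
    determiningSet G ⊆ baseSizeSet G := by
  rintro b ⟨V, hV, hact, hfaith, -, hb⟩
  exact ⟨V, hV, hact, hfaith, hb⟩

end BaseSizes

theorem mainTheorem1 {G : Type*} [CommGroup G] [Finite G] [Nontrivial G] {n : ℕ}
    (d : Fin n → ℕ) (hd : BaseSizes.HasElementaryDivisors G d) :
    BaseSizes.baseSizeSet G = Set.Icc 1 n ∧ BaseSizes.determiningSet G = Set.Icc 1 n := by
  have h1 := BaseSizes.baseSizeSet_subset_Icc hd
  have h2 := BaseSizes.Icc_subset_determiningSet hd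
  have h3 := BaseSizes.determiningSet_subset_baseSizeSet G
  exact ⟨h1.antisymm (h2.trans h3), (h3.trans h1).antisymm h2⟩
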